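/- **Setting.** The language of second-order predicate logic PL II has individual variables $x_0,x_1,\ldots$, for every $n\ge 1$ predicate variables $A^n_0,A^n_1,\ldots$ of arity $n$, and atomic formulas $A^n_i x_{i_1}\cdots x_{i_n}$, $x_i=x_j$, $A^n_i=A^n_j$. Formulas are built with $\neg,\land,\lor,\to,\leftrightarrow$ and quantification over individual and predicate variables, where a variable may be quantified in front of $H$ only if it occurs only free in $H$. A *predicate structure* $\Sigma=(J_n)_{n\ge 0}$ consists of a non-empty set $J_0$ of individuals and, for each $n\ge 1$, a non-empty set $J_n$ of $n$-ary predicates on $J_0$. Individual variables range over $J_0$ and $n$-ary predicate variables over $J_n$. $\Sigma$ is a model of $H$ if $H$ is true in $\Sigma$ under all assignments. $\Sigma$ is a *Henkin-Asser structure* if it is a model of all comprehension axioms $\exists A\,\forall\mathbf x\,(A\mathbf x\leftrightarrow H(\mathbf x))$, where $A$ does not occur in $H$, the variables $\mathbf x$ occur only free in $H$, and $H$ may have other free variables. Write $\mathcal G\models_h H$ if every Henkin-Asser structure that is a model of $\mathcal G$ is a model of $H$. $H$ is *HPL-independent* of $\mathcal G$ if neither $\mathcal G\models_h H$ nor $\mathcal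 G\models_h\neg H$. The *standard structure* over a non-empty set $I$ has $J_0=I$, and $J_n$ is the set of all $n$-ary predicates on $I$. For $n,m\ge 1$, $choice_h^{n,m}$ is the set of all formulas $$\forall\mathbf x\,\exists D\,H(\mathbf x,D)\ \to\ \exists S\,\forall\mathbf x\,\exists D\,\bigl(\forall\mathbf y\,(D\mathbf y\leftrightarrow S\mathbf x\mathbf y)\land H(\mathbf x,D)\bigr),$$ where $\mathbf x=(x_1,\ldots,x_n)$ and $\mathbf y=(y_1,\ldots,y_m)$ are tuples of distinct individual variables with no variable in common, $D$ has arity $m$, $S$ has arity $n+m$ and does not occur in $H$, and $H$ is any formula in which $\mathbf x$ and $D$ occur only free (other free variables are allowed). $WO^1$ is the sentence $\forall A\,\exists T\,wo(T,A)$ with $A$ unary and $T$ binary, where $wo(T,A)$ says that $T$ is a (reflexive) linear ordering of $A$ and that every non-empty unary predicate $B\subseteq A$ has a $T$-least element. **Theorem.** $WO^1$ is HPL-independent of $choice_h^{n,m}$ for all $n,m\ge 1$, and also of $\bigcup_{n,m\ge1}choice_h^{n,m}$. More precisely: 1. There is a Henkin-Asser structure that is a model of $choice_h^{n,m}$ for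 all $n,m\ge 1$ and of $\neg WO^1$. 2. Every standard structure (ZFC being the metatheory) is a Henkin-Asser structure and a model of $WO^1$ and of $choice_h^{n,m}$ for all $n,m\ge 1$. -/

import Mathlib

universe u

namespace HPL

/-! ### The language of second-order predicate logic PL II

Individual variables `x_i` are named by `i : ℕ`; the predicate variables `A_i^n` of sort `n ≥ 1`
are named by a pair `n : ℕ+`, `i : ℕ`. -/

/-- Raw expressions; the formulas of PL II are those which are `Formula.WF`. -/
inductive Formula : Type
  /-- `A_i^n x_{v 1} ⋯ x_{v n}` -/
  | rel (n : ℕ+) (i : ℕ) (v : Fin n → ℕ) : Formula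
  /-- `x_i = x_j` -/
  | eqInd (i j : ℕ) : Formula
  /-- `A_i^n = A_j^n` -/
  | eqPred (n : ℕ+) (i j : ℕ) : Formula
  | neg (H : Formula) : Formula
  | and (H K : Formula) : Formula
  | or (H K : Formula) : Formula
  | imp (H K : Formula) : Formula
  | iff (H K : Formula) : Formula
  /-- `∀ x_i H` -/
  | allInd (i : ℕ) (H : Formula) : Formula
  /-- `∃ x_i H` -/
  | exInd (i : ℕ) (H : Formula) : Formula
  /-- `∀ A_i^n H` -/
  | allPred (n : ℕ+) (i : ℕ) (H : Formula) : Formula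
  /-- `∃ A_i^n H` -/
  | exPred (n : ℕ+) (i : ℕ) (H : Formula) : Formula

namespace Formula

/-- The individual variable `x_k` is quantified somewhere in the formula. -/
def BoundInd (k : ℕ) : Formula → Prop
  | rel _ _ _ => False
  | eqInd _ _ => False
  | eqPred _ _ _ => False
  | neg H => BoundInd k H
  | and H K => BoundInd k H ∨ BoundInd k K
  | or H K => BoundInd k H ∨ BoundInd k K
  | imp H K => BoundInd k H ∨ BoundInd k K
  | iff H K => BoundInd k H ∨ BoundInd k K
  | allInd i H => i = k ∨ BoundInd k H
  | exInd i H => i = k ∨ BoundInd k H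
  | allPred _ _ H => BoundInd k H
  | exPred _ _ H => BoundInd k H

/-- The predicate variable `A_k^p` is quantified somewhere in the formula. -/
def BoundPred (p : ℕ+) (k : ℕ) : Formula → Prop
  | rel _ _ _ => False
  | eqInd _ _ => False
  | eqPred _ _ _ => False
  | neg H => BoundPred p k H
  | and H K => BoundPred p k H ∨ BoundPred p k K
  | or H K => BoundPred p k H ∨ BoundPred p k K
  | imp H K => BoundPred p k H ∨ BoundPred p k K
  | iff H K => BoundPred p k H ∨ BoundPred p k K
  | allInd _ H => BoundPred p k H
  | exInd _ H => BoundPred p k H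
  | allPred n i H => (n = p ∧ i = k) ∨ BoundPred p k H
  | exPred n i H => (n = p ∧ i = k) ∨ BoundPred p k H

/-- The predicate variable `A_k^p` occurs (free or bound) in the formula. -/
def OccursPred (p : ℕ+) (k : ℕ) : Formula → Prop
  | rel n i _ => n = p ∧ i = k
  | eqInd _ _ => False
  | eqPred n i j => n = p ∧ (i = k ∨ j = k)
  | neg H => OccursPred p k H
  | and H K => OccursPred p k H ∨ OccursPred p k K
  | or H K => OccursPred p k H ∨ OccursPred p k K
  | imp H K => OccursPred p k H ∨ OccursPred p k K
  | iff H K => OccursPred p k H ∨ OccursPred p k K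
  | allInd _ H => OccursPred p k H
  | exInd _ H => OccursPred p k H
  | allPred n i H => (n = p ∧ i = k) ∨ OccursPred p k H
  | exPred n i H => (n = p ∧ i = k) ∨ OccursPred p k H

/-- The formation rules of PL II: a variable may be quantified in front of `H` only if it occurs
only free in `H`. -/
def WF : Formula → Prop
  | rel _ _ _ => True
  | eqInd _ _ => True
  | eqPred _ _ _ => True
  | neg H => WF H
  | and H K => WF H ∧ WF K
  | or H K => WF H ∧ WF K
  | imp H K => WF H ∧ WF K
  | iff H K => WF H ∧ WF K
  | allInd i H => ¬ BoundInd i H ∧ WF H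
  | exInd i H => ¬ BoundInd i H ∧ WF H
  | allPred n i H => ¬ BoundPred n i H ∧ WF H
  | exPred n i H => ¬ BoundPred n i H ∧ WF H

/-- `∀ 𝐱 H`, that is `∀ x_1 ⋯ ∀ x_n H`, for a tuple `𝐱` of individual variables. -/
def allTuple : {n : ℕ} → (Fin n → ℕ) → Formula → Formula
  | 0, _, H => H
  | _ + 1, x, H => allInd (x 0) (allTuple (Fin.tail x) H)

end Formula

/-! ### Predicate structures and truth -/

/-- `n`-ary predicates on `I`. -/
abbrev Pred (I : Type u) (n : ℕ+) : Type u := (Fin n → I) → Prop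

/-- A predicate structure `(J_n)_{n ≥ 0}` with `J_0 = I`: the domain of individuals is non-empty and
each `J_n`, `n ≥ 1`, is a non-empty set of `n`-ary predicates on `I`. -/
structure PredStructure (I : Type u) where
  nonempty_ind : Nonempty I
  dom : ∀ n : ℕ+, Set (Pred I n)
  nonempty_dom : ∀ n : ℕ+, (dom n).Nonempty

/-- The standard structure over `I`: all predicates belong to it. -/
def standard (I : Type u) [h : Nonempty I] : PredStructure I where
  nonempty_ind := h
  dom _ := Set.univ
  nonempty_dom _ := Set.univ_nonempty

/-- Assignments in a predicate structure. -/
structure Assignment {I : Type u} (M : PredStructure I) where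
  ind : ℕ → I
  pred : ∀ n : ℕ+, ℕ → M.dom n

namespace Assignment

variable {I : Type u} {M : PredStructure I}

/-- `f⟨x_i / ξ⟩` -/
def updInd (f : Assignment M) (i : ℕ) (ξ : I) : Assignment M where
  ind := Function.update f.ind i ξ
  pred := f.pred

/-- `f⟨A_i^n / α⟩` -/
def updPred (f : Assignment M) (n : ℕ+) (i : ℕ) (α : M.dom n) : Assignment M where
  ind := f.ind
  pred := Function.update f.pred n (Function.update (f.pred n) i α)

end Assignment

/-- `Sat M H f`: the formula `H` is true in `M` under the assignment `f`. -/
def Sat {I : Type u} (M : PredStructure I) : Formula → Assignment M → Prop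
  | .rel n i v, f => (f.pred n i).1 (fun k => f.ind (v k))
  | .eqInd i j, f => f.ind i = f.ind j
  | .eqPred n i j, f => f.pred n i = f.pred n j
  | .neg H, f => ¬ Sat M H f
  | .and H K, f => Sat M H f ∧ Sat M K f
  | .or H K, f => Sat M H f ∨ Sat M K f
  | .imp H K, f => Sat M H f → Sat M K f
  | .iff H K, f => (Sat M H f ↔ Sat M K f)
  | .allInd i H, f => ∀ ξ : I, Sat M H (f.updInd i ξ)
  | .exInd i H, f => ∃ ξ : I, Sat M H (f.updInd i ξ)
  | .allPred n i H, f => ∀ α : M.dom n, Sat M H (f.updPred n i α)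
  | .exPred n i H, f => ∃ α : M.dom n, Sat M H (f.updPred n i α)

/-- `M` is a model of `H`: `H` is true in `M` under every assignment. -/
def Models {I : Type u} (M : PredStructure I) (H : Formula) : Prop :=
  ∀ f : Assignment M, Sat M H f

/-- `M` is a model of the set `G` of formulas. -/
def ModelsSet {I : Type u} (M : PredStructure I) (G : Set Formula) : Prop :=
  ∀ H ∈ G, Models M H

/-! ### Henkin structures and consequence in HPL -/

/-- The comprehension axioms `∃ A ∀ 𝐱 (A 𝐱 ↔ H(𝐱))`, where the variables `𝐱` occur only free in `H`
and `A` does not occur in `H` (other free variables are allowed). -/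
def comprehension : Set Formula :=
  {F | ∃ (n : ℕ+) (a : ℕ) (x : Fin n → ℕ) (H : Formula),
    H.WF ∧ Function.Injective x ∧ (∀ k, ¬ H.BoundInd (x k)) ∧ ¬ H.OccursPred n a ∧
    F = .exPred n a (.allTuple x (.iff (.rel n a x) H))}

/-- Henkin-Asser structures: the predicate structures that satisfy comprehension. -/
def IsHenkin {I : Type u} (M : PredStructure I) : Prop :=
  ModelsSet M comprehension

/-- `G ⊨_h H`: every Henkin structure that is a model of `G` is a model of `H`. -/
def Entails (G : Set Formula) (H : Formula) : Prop :=
  ∀ (I : Type u) (M : PredStructure I), IsHenkin M → ModelsSet M G → Models M H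

/-- `H` is HPL-independent of `G`: neither `H` nor `¬ H` follows from `G` in HPL. -/
def Independent (H : Formula) (G : Set Formula) : Prop :=
  ¬ Entails.{u} G H ∧ ¬ Entails.{u} G (.neg H)

/-! ### The Ackermann axioms -/

/-- `∀ 𝐱 ∃ D H(𝐱,D) → ∃ S ∀ 𝐱 ∃ D (∀ 𝐲 (D 𝐲 ↔ S 𝐱 𝐲) ∧ H(𝐱,D))`
with `D = A_d^m` and `S = A_s^{n+m}`. -/
def choiceFormula (n m : ℕ+) (x : Fin n → ℕ) (y : Fin m → ℕ) (d s : ℕ) (H : Formula) : Formula :=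
  .imp (.allTuple x (.exPred m d H))
    (.exPred (n + m) s (.allTuple x (.exPred m d
      (.and (.allTuple y (.iff (.rel m d y) (.rel (n + m) s (Fin.append x y)))) H))))

/-- The set `choice_h^{n,m}` of Ackermann axioms: `H` is any formula in which `𝐱` and `D` occur only
free (other free variables are allowed), and `S` is a new variable. -/
def choiceH (n m : ℕ+) : Set Formula :=
  {F | ∃ (x : Fin n → ℕ) (y : Fin m → ℕ) (d s : ℕ) (H : Formula),
    H.WF ∧ Function.Injective x ∧ Function.Injective y ∧ (∀ k l, x k ≠ y l) ∧
    (∀ k, ¬ H.BoundInd (x k)) ∧ ¬ H.BoundPred m d ∧ ¬ H.OccursPred (n + m) s ∧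
    F = choiceFormula n m x y d s H}

/-- The set `choice_h^{(2)}` of all Ackermann axioms. -/
def choiceHAll : Set Formula := ⋃ (n : ℕ+) (m : ℕ+), choiceH n m

/-! ### The well-ordering principle -/

/-- `A_a^1 x_i` -/
def un (a i : ℕ) : Formula := .rel 1 a (fun _ => i)

/-- `A_t^2 x_i x_j` -/
def bin (t i j : ℕ) : Formula := .rel 2 t ![i, j]

/-- `lo(T,A)`, with `T = A_t^2` and `A = A_a^1`: the relation `T` is a (reflexive) linear ordering
of `A`. -/
def lo (t a : ℕ) : Formula :=
  .and (.allInd 0 (.imp (un a 0) (bin t 0 0)))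
  (.and (.allInd 0 (.allInd 1 (.imp (.and (un a 0) (un a 1))
      (.imp (.and (bin t 0 1) (bin t 1 0)) (.eqInd 0 1)))))
  (.and (.allInd 0 (.allInd 1 (.allInd 2
      (.imp (.and (un a 0) (.and (un a 1) (un a 2)))
        (.imp (.and (bin t 0 1) (bin t 1 2)) (bin t 0 2))))))
  (.allInd 0 (.allInd 1 (.imp (.and (un a 0) (un a 1)) (.or (bin t 0 1) (bin t 1 0)))))))

/-- `wo(T,A)`, with `T = A_t^2`, `A = A_a^1` and the auxiliary variable `B = A_b^1` (`b ≠ a`):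
`lo(T,A)`, and each non-empty `B ⊆ A` has a `T`-least element. -/
def wo (t a b : ℕ) : Formula :=
  .and (lo t a)
    (.allPred 1 b (.imp
      (.and (.exInd 0 (un b 0)) (.allInd 0 (.imp (un b 0) (un a 0))))
      (.exInd 0 (.and (un b 0) (.allInd 1 (.imp (un b 1) (bin t 0 1)))))))

/-- `WO^1`: `∀ A ∃ T wo(T,A)`. -/
def WO1 : Formula := .allPred 1 0 (.exPred 2 0 (wo 0 0 1))

end HPL

/-! The model of `¬ WO1` is the second-order form of Fraenkel's permutation model: over an infinite
set `I`, keep exactly the predicates invariant under all permutations that fix some finite set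
pointwise. Truth is invariant under permutations (`sat_permAssignment`), and a formula has only
finitely many parameters, each finitely supported. Every definable predicate is therefore finitely
supported, which is comprehension. A linear ordering of `I` would be invariant under the swap of two
individuals outside its support, contradicting antisymmetry.

The Ackermann axioms survive because the choice is indexed by tuples `ξ` of individuals, so a
witness `D` for `ξ` may have the entries of `ξ` in its support. Only finitely many types of tuples
exist over the finite support `P` of the parameters, so one bound on the size of supports serves for
all `ξ`. Permutations fixing `P` and `ξ` then move a witness to one supported by `Q ∪ range ξ`, with
a single finite `Q` (`exists_uniform_support`). One witness per orbit of the pointwise stabilizer of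
`Q`, transported along the orbit, gives an equivariant choice function (`exists_supported_choice`);
equivariance says that `S` is supported by `Q`.

In standard structures everything follows from choice and well-ordering in the metatheory. -/

namespace HPL

/-! ### Semantics of tuples of quantifiers and coincidence -/

section Semantics

variable {I : Type u} {M : PredStructure I}

/-- `f⟨𝐱 / ξ⟩` for a tuple `𝐱` of individual variables. -/
noncomputable def Assignment.updTuple (f : Assignment M) {n : ℕ} (x : Fin n → ℕ) (ξ : Fin n → I) :
    Assignment M where
  ind := Function.extend x ξ f.ind
  pred := f.pred

lemma Assignment.updInd_updTuple_tail (f : Assignment M) {n : ℕ} {x : Fin (n + 1) → ℕ}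
    (hx : Function.Injective x) (a : I) (ξ : Fin n → I) :
    (f.updInd (x 0) a).updTuple (Fin.tail x) ξ = f.updTuple x (Fin.cons a ξ) := by
  have htail : Function.Injective (Fin.tail x) := fun i j h => Fin.succ_injective _ (hx h)
  simp only [updTuple, updInd, mk.injEq, and_true]
  funext k
  by_cases hk : ∃ i, x i = k
  · obtain ⟨i, rfl⟩ := hk
    rw [hx.extend_apply]
    refine Fin.cases ?_ (fun j => ?_) i
    · rw [Function.extend_apply']
      · simp
      · rintro ⟨j, hj⟩
        exact Fin.succ_ne_zero j (hx hj)
    · exact htail.extend_apply _ _ j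
  · rw [Function.extend_apply' _ _ _ hk, Function.extend_apply', Function.update_of_ne]
    · rintro rfl
      exact hk ⟨0, rfl⟩
    · rintro ⟨j, hj⟩
      exact hk ⟨j.succ, hj⟩

lemma sat_allTuple {n : ℕ} {x : Fin n → ℕ} (hx : Function.Injective x) (H : Formula)
    (f : Assignment M) :
    Sat M (.allTuple x H) f ↔ ∀ ξ : Fin n → I, Sat M H (f.updTuple x ξ) := by
  induction n generalizing f with
  | zero =>
    have h : ∀ ξ : Fin 0 → I, f.updTuple x ξ = f := fun ξ => by
      simp only [Assignment.updTuple]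
      congr 1
      funext k
      exact Function.extend_apply' _ _ _ (fun ⟨i, _⟩ => i.elim0)
    simp [h, Formula.allTuple]
  | succ n ih =>
    have htail : Function.Injective (Fin.tail x) := fun i j h => Fin.succ_injective _ (hx h)
    simp only [Formula.allTuple, Sat, ih htail, f.updInd_updTuple_tail hx]
    exact (Fin.forall_fin_succ_pi (P := fun ξ => Sat M H (f.updTuple x ξ))).symm

lemma updPred_pred_same (f : Assignment M) (n : ℕ+) (i : ℕ) (α : M.dom n) :
    (f.updPred n i α).pred n i = α := by
  simp [Assignment.updPred]

lemma updPred_pred_of_ne (f : Assignment M) {n p : ℕ+} {i k : ℕ} (α : M.dom n)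
    (h : ¬ (n = p ∧ i = k)) : (f.updPred n i α).pred p k = f.pred p k := by
  simp only [Assignment.updPred]
  by_cases hp : p = n
  · subst hp
    rw [Function.update_self, Function.update_of_ne]
    rintro rfl
    exact h ⟨rfl, rfl⟩
  · rw [Function.update_of_ne hp]

/-- The assignments `f` and `g` agree on the individual variables in `V` and the predicate variables
in `W`. -/
def AgreeOn (V : Set ℕ) (W : Set (ℕ+ × ℕ)) (f g : Assignment M) : Prop :=
  (∀ i ∈ V, f.ind i = g.ind i) ∧ ∀ p ∈ W, f.pred p.1 p.2 = g.pred p.1 p.2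

variable {V V' : Set ℕ} {W W' : Set (ℕ+ × ℕ)} {f g : Assignment M}

lemma AgreeOn.mono (hV : V ⊆ V') (hW : W ⊆ W') (h : AgreeOn V' W' f g) : AgreeOn V W f g :=
  ⟨fun i hi => h.1 i (hV hi), fun p hp => h.2 p (hW hp)⟩

lemma AgreeOn.updInd (h : AgreeOn V W f g) (i : ℕ) (a : I) :
    AgreeOn V W (f.updInd i a) (g.updInd i a) := by
  refine ⟨fun k hk => ?_, h.2⟩
  simp only [Assignment.updInd, Function.update_apply]
  split_ifs
  · rfl
  · exact h.1 k hk

lemma AgreeOn.updPred (h : AgreeOn V W f g) (n : ℕ+) (i : ℕ) (α : M.dom n) :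
    AgreeOn V W (f.updPred n i α) (g.updPred n i α) := by
  refine ⟨h.1, fun p hp => ?_⟩
  by_cases hn : n = p.1 ∧ i = p.2
  · obtain ⟨p, k⟩ := p
    obtain ⟨rfl, rfl⟩ := hn
    rw [updPred_pred_same, updPred_pred_same]
  · rw [updPred_pred_of_ne _ _ hn, updPred_pred_of_ne _ _ hn]
    exact h.2 p hp

lemma AgreeOn.updTuple (h : AgreeOn V W f g) {n : ℕ} (x : Fin n → ℕ) (ξ : Fin n → I) :
    AgreeOn V W (f.updTuple x ξ) (g.updTuple x ξ) := by
  refine ⟨fun k hk => ?_, h.2⟩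
  simp only [Assignment.updTuple, Function.extend]
  split_ifs
  · rfl
  · exact h.1 k hk

/-- Truth of a formula depends on the values of finitely many variables only, and on no predicate
variable which does not occur. -/
lemma exists_finite_sat_iff (M : PredStructure I) (H : Formula) :
    ∃ (V : Set ℕ) (W : Set (ℕ+ × ℕ)), V.Finite ∧ W.Finite ∧
      (∀ p ∈ W, H.OccursPred p.1 p.2) ∧
      ∀ f g : Assignment M, AgreeOn V W f g → (Sat M H f ↔ Sat M H g) := by
  induction H with
  | rel n i v =>
    refine ⟨Set.range v, {(n, i)}, Set.finite_range v, Set.finite_singleton _, ?_, ?_⟩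
    · rintro p rfl
      exact ⟨rfl, rfl⟩
    · intro f g h
      simp only [Sat, h.2 (n, i) rfl, fun k => h.1 (v k) ⟨k, rfl⟩]
  | eqInd i j =>
    refine ⟨{i, j}, ∅, by simp, by simp, by simp, fun f g h => ?_⟩
    simp only [Sat, h.1 i (by simp), h.1 j (by simp)]
  | eqPred n i j =>
    refine ⟨∅, {(n, i), (n, j)}, by simp, by simp, ?_, fun f g h => ?_⟩
    · rintro p (rfl | rfl) <;> simp [Formula.OccursPred]
    · simp only [Sat, h.2 (n, i) (by simp), h.2 (n, j) (by simp)]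
  | neg H ih =>
    obtain ⟨V, W, hV, hW, hO, h⟩ := ih
    exact ⟨V, W, hV, hW, hO, fun f g hfg => not_congr (h f g hfg)⟩
  | and H K ihH ihK | or H K ihH ihK | imp H K ihH ihK | iff H K ihH ihK =>
    obtain ⟨V, W, hV, hW, hO, h⟩ := ihH
    obtain ⟨V', W', hV', hW', hO', h'⟩ := ihK
    refine ⟨V ∪ V', W ∪ W', hV.union hV', hW.union hW', ?_, fun f g hfg => ?_⟩
    · rintro p (hp | hp)
      · exact Or.inl (hO p hp)
      · exact Or.inr (hO' p hp)
    · simp only [Sat, h f g (hfg.mono Set.subset_union_left Set.subset_union_left),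
        h' f g (hfg.mono Set.subset_union_right Set.subset_union_right)]
  | allInd i H ih =>
    obtain ⟨V, W, hV, hW, hO, h⟩ := ih
    exact ⟨V, W, hV, hW, hO, fun f g hfg => forall_congr' fun a => h _ _ (hfg.updInd i a)⟩
  | exInd i H ih =>
    obtain ⟨V, W, hV, hW, hO, h⟩ := ih
    exact ⟨V, W, hV, hW, hO, fun f g hfg => exists_congr fun a => h _ _ (hfg.updInd i a)⟩
  | allPred n i H ih =>
    obtain ⟨V, W, hV, hW, hO, h⟩ := ih
    exact ⟨V, W, hV, hW, fun p hp => Or.inr (hO p hp),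
      fun f g hfg => forall_congr' fun a => h _ _ (hfg.updPred n i a)⟩
  | exPred n i H ih =>
    obtain ⟨V, W, hV, hW, hO, h⟩ := ih
    exact ⟨V, W, hV, hW, fun p hp => Or.inr (hO p hp),
      fun f g hfg => exists_congr fun a => h _ _ (hfg.updPred n i a)⟩

/-- Discharges the freshness conditions on `A` in comprehension and on `S` in the Ackermann axioms.
-/
lemma sat_congr_of_not_occursPred {H : Formula} {n : ℕ+} {a : ℕ} (ha : ¬ H.OccursPred n a)
    (hind : f.ind = g.ind) (hpred : ∀ p k, ¬ (n = p ∧ a = k) → f.pred p k = g.pred p k) :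
    Sat M H f ↔ Sat M H g := by
  obtain ⟨V, W, -, -, hO, h⟩ := exists_finite_sat_iff M H
  refine h f g ⟨fun i _ => by rw [hind], fun p hp => hpred _ _ ?_⟩
  rintro ⟨rfl, rfl⟩
  exact ha (hO _ hp)

/-- Semantic form of comprehension. -/
lemma isHenkin_of_forall
    (h : ∀ (n : ℕ+) (x : Fin n → ℕ) (H : Formula) (f : Assignment M), Function.Injective x →
      (fun ξ => Sat M H (f.updTuple x ξ)) ∈ M.dom n) : IsHenkin M := by
  rintro F ⟨n, a, x, H, -, hx, -, ha, rfl⟩ f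
  refine ⟨⟨_, h n x H f hx⟩, (sat_allTuple hx _ _).2 fun ξ => ?_⟩
  have hH : Sat M H ((f.updPred n a ⟨_, h n x H f hx⟩).updTuple x ξ) ↔
      Sat M H (f.updTuple x ξ) :=
    sat_congr_of_not_occursPred ha rfl fun p k hpk => updPred_pred_of_ne f _ hpk
  have hxξ : (fun k => Function.extend x ξ f.ind (x k)) = ξ := funext (hx.extend_apply _ _)
  simp only [Sat, hH]
  change ((f.updPred n a _).pred n a).1 (fun k => Function.extend x ξ f.ind (x k)) ↔ _
  rw [updPred_pred_same, hxξ]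

/-- Semantic form of the Ackermann axioms. -/
lemma modelsSet_choiceH_of_forall {n m : ℕ+}
    (h : ∀ (x : Fin n → ℕ) (d : ℕ) (H : Formula) (f : Assignment M), Function.Injective x →
      (∀ ξ, ∃ D : M.dom m, Sat M H ((f.updTuple x ξ).updPred m d D)) →
      ∃ D : (Fin n → I) → M.dom m,
        (fun v : Fin (n + m) → I =>
          (D fun i => v (Fin.castAdd m i)).1 fun j => v (Fin.natAdd n j)) ∈ M.dom (n + m) ∧
        ∀ ξ, Sat M H ((f.updTuple x ξ).updPred m d (D ξ))) : ModelsSet M (choiceH n m) := by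
  rintro F ⟨x, y, d, s, H, -, hx, hy, hxy, -, -, hs, rfl⟩ f
  intro hyp
  rw [sat_allTuple hx] at hyp
  obtain ⟨D, hS, hD⟩ := h x d H f hx hyp
  let S : M.dom (n + m) := ⟨_, hS⟩
  refine ⟨S, (sat_allTuple hx _ _).2 fun ξ => ?_⟩
  have hDS : ∀ η, (D ξ).1 η ↔ S.1 (Fin.append ξ η) := fun η =>
    iff_of_eq (congrArg₂ (fun u w => (D u).1 w) (funext (Fin.append_left ξ η))
      (funext (Fin.append_right ξ η))).symm
  refine ⟨D ξ, (sat_allTuple hy _ _).2 fun η => ?_, ?_⟩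
  -- `D` and `S` are different variables since their arities differ by `n ≥ 1`; hence updating `D`
  -- leaves `S` alone.
  · have hnm : ¬ (m = n + m ∧ d = s) := fun h => by
      have h1 := congrArg PNat.val h.1
      have h2 := n.pos
      rw [PNat.add_coe] at h1
      omega
    have h1 : (fun k => Function.extend y η (Function.extend x ξ f.ind) (y k)) = η :=
      funext (hy.extend_apply _ _)
    have h2 : (fun k => Function.extend y η (Function.extend x ξ f.ind)
        (Fin.append x y k)) = Fin.append ξ η := by
      funext k
      refine Fin.addCases (fun i => ?_) (fun j => ?_) k
      · rw [Fin.append_left, Fin.append_left, Function.extend_apply', hx.extend_apply]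
        rintro ⟨j, hj⟩
        exact hxy i j hj.symm
      · rw [Fin.append_right, Fin.append_right, hy.extend_apply]
    change (((((f.updPred (n + m) s S).updTuple x ξ).updPred m d (D ξ)).pred m d).1
        (fun k => Function.extend y η (Function.extend x ξ f.ind) (y k))) ↔
      (((((f.updPred (n + m) s S).updTuple x ξ).updPred m d (D ξ)).pred (n + m) s).1
        (fun k => Function.extend y η (Function.extend x ξ f.ind) (Fin.append x y k)))
    rw [updPred_pred_same, updPred_pred_of_ne _ _ hnm]
    change _ ↔ ((f.updPred (n + m) s S).pred (n + m) s).1 _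
    rw [updPred_pred_same]
    exact (iff_of_eq (congrArg (D ξ).1 h1)).trans
      ((hDS η).trans (iff_of_eq (congrArg S.1 h2)).symm)
  · refine (sat_congr_of_not_occursPred
      (f := ((f.updPred (n + m) s S).updTuple x ξ).updPred m d (D ξ))
      (g := (f.updTuple x ξ).updPred m d (D ξ)) hs rfl fun p k hpk => ?_).2 (hD ξ)
    by_cases hd : m = p ∧ d = k
    · obtain ⟨rfl, rfl⟩ := hd
      rw [updPred_pred_same, updPred_pred_same]
    · rw [updPred_pred_of_ne _ _ hd, updPred_pred_of_ne _ _ hd]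
      exact updPred_pred_of_ne _ _ hpk

end Semantics

lemma modelsSet_choiceHAll {I : Type u} {M : PredStructure I}
    (h : ∀ n m, ModelsSet M (choiceH n m)) : ModelsSet M choiceHAll := by
  intro F hF
  simp only [choiceHAll, Set.mem_iUnion] at hF
  obtain ⟨n, m, hF⟩ := hF
  exact h n m F hF

/-! ### Standard structures -/

section Standard

variable (I : Type u) [Nonempty I]

lemma isHenkin_standard : IsHenkin (standard I) :=
  isHenkin_of_forall fun _ _ _ _ _ => Set.mem_univ _

lemma modelsSet_choiceH_standard (n m : ℕ+) : ModelsSet (standard I) (choiceH n m) := by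
  refine modelsSet_choiceH_of_forall fun x d H f _ hyp => ?_
  choose D hD using hyp
  exact ⟨D, Set.mem_univ _, hD⟩

lemma models_WO1_standard : Models (standard I) WO1 := by
  intro f A
  -- A well-ordering of all of `I` well-orders every `A`, so `T` need not depend on `A`.
  obtain ⟨_, hwf⟩ := exists_wellFoundedLT I
  refine ⟨⟨fun v : Fin 2 → I => v 0 ≤ v 1, Set.mem_univ _⟩, ?_, ?_⟩
  · refine ⟨?_, ?_, ?_, ?_⟩
    · intro a _
      exact le_refl a
    · intro a b _ h
      exact le_antisymm h.1 h.2
    · intro a b c _ h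
      exact le_trans h.1 h.2
    · intro a b _
      exact le_total a b
  · rintro B ⟨⟨b, hb⟩, -⟩
    have hne : {a : I | B.1 fun _ => a}.Nonempty := ⟨b, hb⟩
    refine ⟨hwf.wf.min _ hne, hwf.wf.min_mem _ hne, fun c hc => ?_⟩
    exact not_lt.1 (hwf.wf.not_lt_min _ hc)

end Standard

/-! ### Finitely supported predicates -/

section Support

variable {I : Type u}

/-- The image `π(α)` of a predicate under a permutation of the individuals. -/
def permPred (π : Equiv.Perm I) {n : ℕ} (α : (Fin n → I) → Prop) : (Fin n → I) → Prop :=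
  fun v => α (π.symm ∘ v)

/-- `π` fixes each element of `E`. -/
def Fixes (π : Equiv.Perm I) (E : Set I) : Prop := ∀ e ∈ E, π e = e

/-- `α` is invariant under the permutations which fix each element of `E`. -/
def Supports (E : Set I) {n : ℕ} (α : (Fin n → I) → Prop) : Prop :=
  ∀ π, Fixes π E → permPred π α = α

lemma Fixes.symm {π : Equiv.Perm I} {E : Set I} (h : Fixes π E) : Fixes π.symm E :=
  fun e he => by rw [Equiv.symm_apply_eq, h e he]

lemma Fixes.mono {π : Equiv.Perm I} {E F : Set I} (hEF : E ⊆ F) (h : Fixes π F) : Fixes π E :=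
  fun e he => h e (hEF he)

lemma Fixes.trans {π σ : Equiv.Perm I} {E : Set I} (h : Fixes π E) (h' : Fixes σ E) :
    Fixes (π.trans σ) E :=
  fun e he => by rw [Equiv.trans_apply, h e he, h' e he]

lemma permPred_trans (π σ : Equiv.Perm I) {n : ℕ} (α : (Fin n → I) → Prop) :
    permPred (π.trans σ) α = permPred σ (permPred π α) := rfl

lemma permPred_symm_permPred (π : Equiv.Perm I) {n : ℕ} (α : (Fin n → I) → Prop) :
    permPred π.symm (permPred π α) = α := by
  funext v
  simp [permPred, ← Function.comp_assoc]

lemma permPred_permPred_symm (π : Equiv.Perm I) {n : ℕ} (α : (Fin n → I) → Prop) :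
    permPred π (permPred π.symm α) = α := by
  simpa using permPred_symm_permPred π.symm α

lemma Supports.mono {E F : Set I} (hEF : E ⊆ F) {n : ℕ} {α : (Fin n → I) → Prop}
    (h : Supports E α) : Supports F α :=
  fun π hπ => h π (hπ.mono hEF)

/-- If `σ` fixes `π(E)` pointwise, its conjugate `π⁻¹σπ` fixes `E` pointwise. -/
lemma Supports.permPred {E : Set I} {n : ℕ} {α : (Fin n → I) → Prop} (h : Supports E α)
    (π : Equiv.Perm I) : Supports (π '' E) (permPred π α) := by
  intro σ hσ
  have hfix : Fixes ((π.trans σ).trans π.symm) E := fun e he => by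
    simp [hσ (π e) ⟨e, he, rfl⟩]
  have := congrArg (HPL.permPred π) (h _ hfix)
  rwa [permPred_trans, permPred_trans, permPred_permPred_symm] at this

/-- `σ⁻¹π` fixes `E`, so the image of a predicate depends only on the action on a support. This
makes transport along orbits well defined. -/
lemma Supports.permPred_congr {E : Set I} {n : ℕ} {α : (Fin n → I) → Prop} (h : Supports E α)
    {π σ : Equiv.Perm I} (hπσ : ∀ e ∈ E, π e = σ e) :
    HPL.permPred π α = HPL.permPred σ α := by
  have hfix : Fixes (π.trans σ.symm) E := fun e he => by simp [hπσ e he]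
  have := congrArg (HPL.permPred σ) (h _ hfix)
  rwa [permPred_trans, permPred_permPred_symm] at this

/-- An injection of a finite set of individuals extends to a permutation. -/
lemma exists_perm_extend {A : Set I} (hA : A.Finite) {g : I → I} (hg : Set.InjOn g A) :
    ∃ π : Equiv.Perm I, ∀ a ∈ A, π a = g a := by
  have := hA.fintype
  let e := (Fintype.equivFin A).symm
  let u : Fin (Fintype.card A) ↪ I := e.toEmbedding.trans (Function.Embedding.subtype _)
  let v : Fin (Fintype.card A) ↪ I :=
    e.toEmbedding.trans ⟨fun a : A => g a, fun a b h => Subtype.ext (hg a.2 b.2 h)⟩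
  have := Equiv.Perm.isMultiplyPretransitive I (Fintype.card A)
  obtain ⟨π, hπ⟩ := MulAction.exists_smul_eq (Equiv.Perm I) u v
  refine ⟨π, fun a ha => ?_⟩
  have := DFunLike.congr_fun hπ (e.symm ⟨a, ha⟩)
  simpa [u, v] using! this

/-- Tuples of the same type over `P` are conjugate under a permutation which fixes `P`. -/
lemma exists_perm_of_same_type {P : Set I} (hP : P.Finite) {n : ℕ} {ξ ξ' : Fin n → I}
    (h : ∀ i j, ξ i = ξ j ↔ ξ' i = ξ' j) (hp : ∀ i, ∀ p ∈ P, ξ i = p ↔ ξ' i = p) :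
    ∃ π : Equiv.Perm I, Fixes π P ∧ π ∘ ξ = ξ' := by
  classical
  -- Send `ξ i` to `ξ' i` and fix all else; equality of types makes this independent of the chosen
  -- `i` and injective on `P ∪ range ξ`.
  let g : I → I := fun a => if h : ∃ i, ξ i = a then ξ' h.choose else a
  have hgξ : ∀ i, g (ξ i) = ξ' i := fun i => by
    have hi : ∃ j, ξ j = ξ i := ⟨i, rfl⟩
    simp only [g, dif_pos hi]
    exact (h _ _).1 hi.choose_spec
  have hgP : ∀ p ∈ P, g p = p := fun p hpP => by
    by_cases hi : ∃ j, ξ j = p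
    · simp only [g, dif_pos hi]
      exact (hp _ p hpP).1 hi.choose_spec
    · simp only [g, dif_neg hi]
  have hinj : Set.InjOn g (P ∪ Set.range ξ) := by
    rintro a (ha | ⟨i, rfl⟩) b (hb | ⟨j, rfl⟩) hab
    · rwa [hgP a ha, hgP b hb] at hab
    · rw [hgP a ha, hgξ] at hab
      exact ((hp j a ha).2 hab.symm).symm
    · rw [hgP b hb, hgξ] at hab
      exact (hp i b hb).2 hab
    · rw [hgξ, hgξ] at hab
      exact (h i j).2 hab
  obtain ⟨π, hπ⟩ := exists_perm_extend (hP.union (Set.finite_range ξ)) hinj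
  refine ⟨π, fun p hpP => (hπ p (Or.inl hpP)).trans (hgP p hpP), funext fun i => ?_⟩
  exact (hπ _ (Or.inr ⟨i, rfl⟩)).trans (hgξ i)

/-- A finite set `E` can be moved into `B ∪ Z` by a permutation which fixes `B`, if the part of `Z`
outside `B` is large enough. -/
lemma exists_perm_image_subset {B E Z : Set I} (hB : B.Finite) (hE : E.Finite)
    (hZ : Disjoint Z B) (hcard : E.encard ≤ Z.encard) :
    ∃ π : Equiv.Perm I, Fixes π B ∧ π '' E ⊆ B ∪ Z := by
  classical
  rcases isEmpty_or_nonempty I with hI | hI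
  · exact ⟨1, fun _ _ => rfl, fun a => hI.elim a⟩
  obtain ⟨k, hkZ, hk⟩ := hE.exists_injOn_of_encard_le hcard
  let g : I → I := fun a => if a ∈ B then a else k a
  have hgB : ∀ b ∈ B, g b = b := fun b hb => if_pos hb
  have hgE : ∀ a ∈ E, a ∉ B → g a = k a := fun a _ ha => if_neg ha
  have hinj : Set.InjOn g (B ∪ E) := by
    intro a ha b hb hab
    by_cases haB : a ∈ B <;> by_cases hbB : b ∈ B
    · rwa [hgB a haB, hgB b hbB] at hab
    · have hbE := hb.resolve_left hbB
      rw [hgB a haB, hgE b hbE hbB] at hab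
      exact (Set.disjoint_left.1 hZ (hkZ hbE) (hab ▸ haB)).elim
    · have haE := ha.resolve_left haB
      rw [hgB b hbB, hgE a haE haB] at hab
      exact (Set.disjoint_left.1 hZ (hkZ haE) (hab ▸ hbB)).elim
    · have haE := ha.resolve_left haB
      have hbE := hb.resolve_left hbB
      rw [hgE a haE haB, hgE b hbE hbB] at hab
      exact hk haE hbE hab
  obtain ⟨π, hπ⟩ := exists_perm_extend (hB.union hE) hinj
  refine ⟨π, fun b hb => (hπ b (Or.inl hb)).trans (hgB b hb), ?_⟩
  rintro _ ⟨a, ha, rfl⟩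
  rw [hπ a (Or.inr ha)]
  by_cases haB : a ∈ B
  · rw [hgB a haB]
    exact Or.inl haB
  · rw [hgE a ha haB]
    exact Or.inr (hkZ ha)

/-! ### Choice for equivariant families -/

variable [Infinite I] {n m : ℕ}

/-- If an equivariant family of sets of finitely supported predicates, indexed by tuples, has
non-empty members, then there is a finite set `Q` such that the member with index `ξ` has an element
supported by `Q` and `ξ`. -/
lemma exists_uniform_support {P : Set I} (hP : P.Finite)
    {R : (Fin n → I) → ((Fin m → I) → Prop) → Prop}
    (hR : ∀ π, Fixes π P → ∀ ξ D, R ξ D → R (π ∘ ξ) (permPred π D))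
    (htot : ∀ ξ, ∃ D, R ξ D ∧ ∃ E : Set I, E.Finite ∧ Supports E D) :
    ∃ Q : Set I, Q.Finite ∧ P ⊆ Q ∧ ∀ ξ, ∃ D, R ξ D ∧ Supports (Q ∪ Set.range ξ) D := by
  classical
  choose D hRD E hE hED using htot
  have := hP.to_subtype
  -- The type of `ξ` over `P`: which entries coincide, and which equal a given element of `P`. The
  -- codomain is finite.
  let τ : (Fin n → I) → (Fin n → Fin n ⊕ P → Prop) := fun ξ i =>
    Sum.elim (fun j => ξ i = ξ j) (fun p => ξ i = p)
  -- `N` bounds the supports of the witnesses at one representative per type; unrealized types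
  -- contribute a harmless arbitrary tuple.
  obtain ⟨N, hN⟩ := (Set.finite_range fun t => (E (Function.invFun τ t)).ncard).bddAbove
  -- Of `n + N` points at least `N` remain when the at most `n` entries of `ξ` are removed.
  obtain ⟨Z, hZP, hZ⟩ := hP.infinite_compl.exists_subset_card_eq (n + N)
  refine ⟨P ∪ Z, hP.union Z.finite_toSet, Set.subset_union_left, fun ξ => ?_⟩
  set ξ₀ := Function.invFun τ (τ ξ) with hξ₀
  have hτ : τ ξ₀ = τ ξ := Function.invFun_eq ⟨ξ, rfl⟩
  obtain ⟨π, hπP, hπξ⟩ := exists_perm_of_same_type hP (ξ := ξ₀) (ξ' := ξ)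
    (fun i j => iff_of_eq (congrFun (congrFun hτ i) (Sum.inl j)))
    (fun i p hp => iff_of_eq (congrFun (congrFun hτ i) (Sum.inr ⟨p, hp⟩)))
  have hsub : N ≤ (Z \ Finset.univ.image ξ).card := by
    have h1 := Finset.le_card_sdiff (Finset.univ.image ξ) Z
    have h2 : (Finset.univ.image ξ).card ≤ n := by
      simpa using (Finset.card_image_le (s := Finset.univ) (f := ξ))
    omega
  -- `π` carries the witness from `ξ₀` to `ξ`; `σ` fixes `P` and `ξ`, so it preserves being a
  -- witness while pushing the support into `P ∪ Z ∪ range ξ`.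
  obtain ⟨σ, hσ, hσE⟩ := exists_perm_image_subset (B := P ∪ Set.range ξ) (E := π '' E ξ₀)
    (Z := ((Z \ Finset.univ.image ξ : Finset I) : Set I)) (hP.union (Set.finite_range ξ))
    ((hE ξ₀).image π)
    (by
      rw [Set.disjoint_left]
      intro a ha hb
      simp only [Finset.coe_sdiff, Finset.coe_image, Finset.coe_univ, Set.image_univ] at ha
      rcases hb with hb | hb
      · exact hZP ha.1 hb
      · exact ha.2 hb)
    (by
      rw [π.injective.encard_image, Set.encard_coe_eq_coe_finsetCard,
        ← (hE ξ₀).cast_ncard_eq]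
      exact_mod_cast (hN ⟨τ ξ, rfl⟩).trans hsub)
  have hσξ : σ ∘ ξ = ξ := funext fun i => hσ _ (Or.inr ⟨i, rfl⟩)
  refine ⟨permPred σ (permPred π (D ξ₀)), ?_, (((hED ξ₀).permPred π).permPred σ).mono ?_⟩
  · have := hR σ (hσ.mono Set.subset_union_left) _ _ (hR π hπP _ _ (hRD ξ₀))
    rwa [hπξ, hσξ] at this
  · intro a ha
    rcases hσE ha with (h | h) | h
    · exact Or.inl (Or.inl h)
    · exact Or.inr h
    · exact Or.inl (Or.inr (Finset.mem_sdiff.1 h).1)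

/-- An equivariant family of sets of finitely supported predicates, indexed by tuples and with
non-empty members, has a finitely supported choice function. -/
lemma exists_supported_choice {P : Set I} (hP : P.Finite)
    {R : (Fin n → I) → ((Fin m → I) → Prop) → Prop}
    (hR : ∀ π, Fixes π P → ∀ ξ D, R ξ D → R (π ∘ ξ) (permPred π D))
    (htot : ∀ ξ, ∃ D, R ξ D ∧ ∃ E : Set I, E.Finite ∧ Supports E D) :
    ∃ (Q : Set I) (D : (Fin n → I) → (Fin m → I) → Prop), Q.Finite ∧
      (∀ ξ, R ξ (D ξ)) ∧
      ∀ π, Fixes π Q → ∀ ξ, D (π ∘ ξ) = permPred π (D ξ) := by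
  obtain ⟨Q, hQ, hPQ, h⟩ := exists_uniform_support hP hR htot
  choose D₀ hRD hsupp using h
  -- Orbits of tuples under the pointwise stabilizer of `Q`.
  let s : Setoid (Fin n → I) :=
    { r := fun ξ ξ' => ∃ π : Equiv.Perm I, Fixes π Q ∧ π ∘ ξ = ξ'
      iseqv :=
        { refl := fun ξ => ⟨1, fun _ _ => rfl, rfl⟩
          symm := by
            rintro ξ _ ⟨π, hπ, rfl⟩
            exact ⟨π.symm, hπ.symm, by simp [← Function.comp_assoc]⟩
          trans := by
            rintro ξ _ _ ⟨π, hπ, rfl⟩ ⟨σ, hσ, rfl⟩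
            exact ⟨π.trans σ, hπ.trans hσ, rfl⟩ } }
  let rep : (Fin n → I) → (Fin n → I) := fun ξ => (Quotient.mk s ξ).out
  have hrep : ∀ ξ, ∃ π : Equiv.Perm I, Fixes π Q ∧ π ∘ rep ξ = ξ :=
    fun ξ => Quotient.exact (s := s) (Quotient.out_eq _)
  choose π hπ hπrep using hrep
  refine ⟨Q, fun ξ => permPred (π ξ) (D₀ (rep ξ)), hQ, fun ξ => ?_,
    fun σ hσ ξ => ?_⟩
  · have := hR (π ξ) ((hπ ξ).mono hPQ) _ _ (hRD (rep ξ))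
    rwa [hπrep] at this
  · have hsame : rep (σ ∘ ξ) = rep ξ := by
      have : Quotient.mk s (σ ∘ ξ) = Quotient.mk s ξ :=
        (Quotient.sound (s := s) (⟨σ, hσ, rfl⟩ : s.r ξ (σ ∘ ξ))).symm
      simp only [rep, this]
    have h1 := hπrep (σ ∘ ξ)
    rw [hsame] at h1
    have h2 := hπrep ξ
    simp only [hsame]
    rw [← permPred_trans]
    -- Both permutations fix `Q` and take `rep ξ` to `σ ∘ ξ`, so they agree on the support of the
    -- witness.
    refine (hsupp (rep ξ)).permPred_congr ?_
    rintro e (he | ⟨i, rfl⟩)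
    · rw [hπ _ e he, Equiv.trans_apply, hπ _ e he, hσ e he]
    · have h3 := congrFun h1 i
      have h4 := congrFun h2 i
      simp only [Function.comp_apply] at h3 h4
      rw [Equiv.trans_apply, h3, h4]

end Support

/-! ### The Fraenkel structure -/

section Fraenkel

variable (I : Type u) [Infinite I]

/-- The structure of all finitely supported predicates on an infinite set `I`. -/
def fraenkel : PredStructure I where
  nonempty_ind := inferInstance
  dom _ := {α | ∃ E : Set I, E.Finite ∧ Supports E α}
  nonempty_dom _ := ⟨fun _ => True, ∅, Set.finite_empty, fun _ _ => rfl⟩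

variable {I}

/-- The action of permutations on the predicates of the Fraenkel structure. -/
def permDom (π : Equiv.Perm I) {n : ℕ+} (α : (fraenkel I).dom n) : (fraenkel I).dom n :=
  ⟨permPred π α.1, by
    obtain ⟨E, hE, h⟩ := α.2
    exact ⟨π '' E, hE.image π, h.permPred π⟩⟩

lemma permDom_permDom_symm (π : Equiv.Perm I) {n : ℕ+} (α : (fraenkel I).dom n) :
    permDom π (permDom π.symm α) = α :=
  Subtype.ext (permPred_permPred_symm π α.1)

lemma permDom_symm_permDom (π : Equiv.Perm I) {n : ℕ+} (α : (fraenkel I).dom n) :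
    permDom π.symm (permDom π α) = α :=
  Subtype.ext (permPred_symm_permPred π α.1)

lemma permDom_injective (π : Equiv.Perm I) {n : ℕ+} :
    Function.Injective (permDom π : (fraenkel I).dom n → (fraenkel I).dom n) :=
  Function.LeftInverse.injective (permDom_symm_permDom π)

lemma permDom_surjective (π : Equiv.Perm I) {n : ℕ+} :
    Function.Surjective (permDom π : (fraenkel I).dom n → (fraenkel I).dom n) :=
  Function.RightInverse.surjective (permDom_permDom_symm π)

/-- The action of permutations on the assignments in the Fraenkel structure. -/
def permAssignment (π : Equiv.Perm I) (f : Assignment (fraenkel I)) :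
    Assignment (fraenkel I) where
  ind := π ∘ f.ind
  pred n i := permDom π (f.pred n i)

lemma permAssignment_updInd (π : Equiv.Perm I) (f : Assignment (fraenkel I)) (i : ℕ) (a : I) :
    permAssignment π (f.updInd i a) = (permAssignment π f).updInd i (π a) := by
  simp only [permAssignment, Assignment.updInd, Function.comp_update]

lemma permAssignment_updTuple (π : Equiv.Perm I) (f : Assignment (fraenkel I)) {n : ℕ}
    (x : Fin n → ℕ) (ξ : Fin n → I) :
    permAssignment π (f.updTuple x ξ) = (permAssignment π f).updTuple x (π ∘ ξ) := by
  simp only [permAssignment, Assignment.updTuple, Assignment.mk.injEq, and_true]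
  funext k
  simp only [Function.comp_apply, Function.extend]
  split_ifs <;> rfl

lemma permAssignment_updPred (π : Equiv.Perm I) (f : Assignment (fraenkel I)) (n : ℕ+) (i : ℕ)
    (α : (fraenkel I).dom n) :
    permAssignment π (f.updPred n i α) = (permAssignment π f).updPred n i (permDom π α) := by
  have : (permAssignment π (f.updPred n i α)).pred =
      ((permAssignment π f).updPred n i (permDom π α)).pred := by
    funext p k
    change permDom π ((f.updPred n i α).pred p k) = _
    by_cases h : n = p ∧ i = k
    · obtain ⟨rfl, rfl⟩ := h
      rw [updPred_pred_same, updPred_pred_same]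
    · rw [updPred_pred_of_ne _ _ h, updPred_pred_of_ne _ _ h]
      rfl
  exact congrArg (Assignment.mk (π ∘ f.ind)) this

/-- Truth in the Fraenkel structure is invariant under permutations. -/
lemma sat_permAssignment (π : Equiv.Perm I) (H : Formula) (f : Assignment (fraenkel I)) :
    Sat (fraenkel I) H (permAssignment π f) ↔ Sat (fraenkel I) H f := by
  induction H generalizing f with
  | rel n i v =>
    change (f.pred n i).1 (π.symm ∘ fun k => π (f.ind (v k))) ↔
      (f.pred n i).1 fun k => f.ind (v k)
    have : (π.symm ∘ fun k => π (f.ind (v k))) = fun k => f.ind (v k) := by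
      funext k
      simp
    rw [this]
  | eqInd i j => exact π.injective.eq_iff
  | eqPred n i j => exact (permDom_injective π).eq_iff
  | neg H ih => exact not_congr (ih f)
  | and H K ihH ihK | or H K ihH ihK | imp H K ihH ihK | iff H K ihH ihK =>
    simp only [Sat, ihH, ihK]
  | allInd i H ih =>
    simp only [Sat]
    rw [← π.forall_congr_right]
    exact forall_congr' fun a => by rw [← permAssignment_updInd, ih]
  | exInd i H ih =>
    simp only [Sat]
    rw [← π.exists_congr_right]
    exact exists_congr fun a => by rw [← permAssignment_updInd, ih]
  | allPred n i H ih =>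
    simp only [Sat]
    rw [(permDom_surjective π).forall]
    exact forall_congr' fun a => by rw [← permAssignment_updPred, ih]
  | exPred n i H ih =>
    simp only [Sat]
    rw [(permDom_surjective π).exists]
    exact exists_congr fun a => by rw [← permAssignment_updPred, ih]

/-- The values of finitely many variables are moved by no permutation which fixes a suitable finite
set. -/
lemma exists_finite_agreeOn {V : Set ℕ} {W : Set (ℕ+ × ℕ)} (hV : V.Finite) (hW : W.Finite)
    (f : Assignment (fraenkel I)) :
    ∃ P : Set I, P.Finite ∧ ∀ π, Fixes π P → AgreeOn V W (permAssignment π f) f := by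
  choose E hE hsupp using fun p : ℕ+ × ℕ => (f.pred p.1 p.2).2
  refine ⟨f.ind '' V ∪ ⋃ p ∈ W, E p, (hV.image _).union (hW.biUnion fun p _ => hE p),
    fun π hπ => ⟨fun i hi => hπ _ (Or.inl ⟨i, hi, rfl⟩), fun p hp => Subtype.ext ?_⟩⟩
  exact hsupp p π (hπ.mono ((Set.subset_biUnion_of_mem hp).trans Set.subset_union_right))

/-- Apply `π` to the whole assignment, which preserves truth; as `π` fixes the supports of the
finitely many relevant parameters, these may be restored to their values under `f`. -/
lemma exists_finite_sat_perm (H : Formula) (f : Assignment (fraenkel I)) :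
    ∃ P : Set I, P.Finite ∧ ∀ π, Fixes π P → ∀ {n : ℕ} (x : Fin n → ℕ) (ξ : Fin n → I),
      (Sat (fraenkel I) H (f.updTuple x (π ∘ ξ)) ↔ Sat (fraenkel I) H (f.updTuple x ξ)) ∧
      ∀ (m : ℕ+) (d : ℕ) (D : (fraenkel I).dom m),
        Sat (fraenkel I) H ((f.updTuple x (π ∘ ξ)).updPred m d (permDom π D)) ↔
          Sat (fraenkel I) H ((f.updTuple x ξ).updPred m d D) := by
  obtain ⟨V, W, hV, hW, -, h⟩ := exists_finite_sat_iff (fraenkel I) H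
  obtain ⟨P, hP, hagree⟩ := exists_finite_agreeOn hV hW f
  refine ⟨P, hP, fun π hπ n x ξ => ⟨?_, fun m d D => ?_⟩⟩
  · rw [← sat_permAssignment π H (f.updTuple x ξ), permAssignment_updTuple]
    exact (h _ _ ((hagree π hπ).updTuple x _)).symm
  · rw [← sat_permAssignment π H ((f.updTuple x ξ).updPred m d D), permAssignment_updPred,
      permAssignment_updTuple]
    exact (h _ _ (((hagree π hπ).updTuple x _).updPred m d _)).symm

lemma isHenkin_fraenkel : IsHenkin (fraenkel I) := by
  refine isHenkin_of_forall fun n x H f _ => ?_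
  obtain ⟨P, hP, h⟩ := exists_finite_sat_perm H f
  exact ⟨P, hP, fun π hπ => funext fun ξ => propext (h π.symm hπ.symm x ξ).1⟩

lemma modelsSet_choiceH_fraenkel (n m : ℕ+) : ModelsSet (fraenkel I) (choiceH n m) := by
  refine modelsSet_choiceH_of_forall fun x d H f _ hyp => ?_
  obtain ⟨P, hP, h⟩ := exists_finite_sat_perm H f
  obtain ⟨Q, D, hQ, hD, hperm⟩ := exists_supported_choice hP
    -- Membership in the domain is part of `R`, so that the choice lemma can speak of arbitrary
    -- predicates.
    (R := fun ξ α => ∃ hα : α ∈ (fraenkel I).dom m,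
      Sat (fraenkel I) H ((f.updTuple x ξ).updPred m d ⟨α, hα⟩))
    (fun π hπ ξ α ⟨hα, hs⟩ => ⟨(permDom π ⟨α, hα⟩).2, ((h π hπ x ξ).2 m d ⟨α, hα⟩).2 hs⟩)
    (fun ξ => (hyp ξ).elim fun α hα => ⟨α.1, ⟨α.2, hα⟩, α.2⟩)
  refine ⟨fun ξ => ⟨D ξ, (hD ξ).1⟩, ⟨Q, hQ, fun π hπ => funext fun v => ?_⟩,
    fun ξ => (hD ξ).2⟩
  change D (π.symm ∘ fun i => v (Fin.castAdd m i)) (π.symm ∘ fun j => v (Fin.natAdd n j)) =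
    D (fun i => v (Fin.castAdd m i)) fun j => v (Fin.natAdd n j)
  -- Equivariance of `D` is invariance of `S`; the inverse appears because `permPred` precomposes
  -- with `π.symm`.
  rw [hperm π.symm hπ.symm]
  simp [permPred, ← Function.comp_assoc]

/-- There is no linear ordering of the set of all individuals in the Fraenkel structure. -/
lemma models_neg_WO1_fraenkel : Models (fraenkel I) (.neg WO1) := by
  classical
  intro f hWO
  -- Take `A` to be the set of all individuals; its support is empty.
  obtain ⟨⟨T, P, hP, hT⟩, ⟨-, hanti, -, htot⟩, -⟩ :=
    hWO ⟨fun _ => True, ∅, Set.finite_empty, fun _ _ => rfl⟩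
  obtain ⟨a, ha⟩ := hP.infinite_compl.nonempty
  obtain ⟨b, hb⟩ := (hP.insert a).infinite_compl.nonempty
  have hba : b ≠ a := fun h => hb (Or.inl h)
  have hbP : b ∉ P := fun h => hb (Or.inr h)
  have hfix : Fixes (Equiv.swap a b) P := fun e he =>
    Equiv.swap_apply_of_ne_of_ne (fun h => ha (h ▸ he)) (fun h => hbP (h ▸ he))
  have hvec : ∀ c d : I, (fun k => Function.update (Function.update f.ind 0 c) 1 d (![0, 1] k)) =
      ![c, d] := fun c d => by
    funext k
    fin_cases k <;> simp
  have hvec' : ∀ c d : I, (fun k => Function.update (Function.update f.ind 0 c) 1 d (![1, 0] k)) =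
      ![d, c] := fun c d => by
    funext k
    fin_cases k <;> simp
  have hanti' : ∀ c d : I, T ![c, d] → T ![d, c] → c = d := fun c d h h' => by
    have := hanti c d ⟨trivial, trivial⟩
      ⟨(iff_of_eq (congrArg T (hvec c d))).2 h, (iff_of_eq (congrArg T (hvec' c d))).2 h'⟩
    simpa [Sat, Assignment.updInd, Assignment.updPred] using this
  have htot' : ∀ c d : I, T ![c, d] ∨ T ![d, c] := fun c d =>
    (htot c d ⟨trivial, trivial⟩).imp (iff_of_eq (congrArg T (hvec c d))).1
      (iff_of_eq (congrArg T (hvec' c d))).1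
  -- The swap of `a` and `b` fixes the support `P` of `T`.
  have hswap : T ![a, b] ↔ T ![b, a] := by
    have hv : (Equiv.swap a b).symm ∘ ![b, a] = ![a, b] := by
      funext k
      fin_cases k <;> simp
    exact (iff_of_eq (congrArg T hv)).symm.trans (iff_of_eq (congrFun (hT _ hfix) ![b, a]))
  rcases htot' a b with h | h
  · exact hba (hanti' a b h (hswap.1 h)).symm
  · exact hba (hanti' a b (hswap.2 h) h).symm

end Fraenkel

lemma nonempty_assignment {I : Type u} (M : PredStructure I) : Nonempty (Assignment M) :=
  ⟨⟨fun _ => M.nonempty_ind.some, fun n _ => ⟨_, (M.nonempty_dom n).some_mem⟩⟩⟩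

/-- Independence from a set of formulas which holds in a Henkin structure without and in a Henkin
structure with the property in question. -/
lemma independent_of_models {G : Set Formula} {H : Formula} {I J : Type u} {M : PredStructure I}
    {N : PredStructure J} (hM : IsHenkin M) (hMG : ModelsSet M G) (hMH : Models M (.neg H))
    (hN : IsHenkin N) (hNG : ModelsSet N G) (hNH : Models N H) : Independent.{u} H G := by
  obtain ⟨f⟩ := nonempty_assignment M
  obtain ⟨g⟩ := nonempty_assignment N
  exact ⟨fun h => hMH f (h I M hM hMG f), fun h => h J N hN hNG g (hNH g)⟩

end HPL

theorem theorem3 :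
    -- `WO^1` is HPL-independent of the Ackermann axioms, for each `n, m` and for all of them
    (∀ n m : ℕ+, HPL.Independent.{u} HPL.WO1 (HPL.choiceH n m)) ∧
    HPL.Independent.{u} HPL.WO1 HPL.choiceHAll ∧
    -- one Henkin-Asser structure satisfies all Ackermann axioms and `¬ WO^1`
    (∃ (I : Type u) (M : HPL.PredStructure I),
      HPL.IsHenkin M ∧ HPL.ModelsSet M HPL.choiceHAll ∧ HPL.Models M (.neg HPL.WO1)) ∧
    -- each standard structure is a Henkin-Asser structure satisfying `WO^1` and all Ackermann axioms
    (∀ (I : Type u) [Nonempty I],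
      HPL.IsHenkin (HPL.standard I) ∧ HPL.Models (HPL.standard I) HPL.WO1 ∧
      HPL.ModelsSet (HPL.standard I) HPL.choiceHAll) := by
  have hall : HPL.ModelsSet (HPL.fraenkel (ULift.{u} ℕ)) HPL.choiceHAll :=
    HPL.modelsSet_choiceHAll HPL.modelsSet_choiceH_fraenkel
  refine ⟨fun n m => ?_, ?_, ⟨_, HPL.fraenkel (ULift.{u} ℕ), HPL.isHenkin_fraenkel, hall,
    HPL.models_neg_WO1_fraenkel⟩, fun I _ => ⟨HPL.isHenkin_standard I,
    HPL.models_WO1_standard I, HPL.modelsSet_choiceHAll (HPL.modelsSet_choiceH_standard I)⟩⟩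
  · exact HPL.independent_of_models HPL.isHenkin_fraenkel
      (HPL.modelsSet_choiceH_fraenkel (I := ULift.{u} ℕ) n m) HPL.models_neg_WO1_fraenkel
      (HPL.isHenkin_standard PUnit) (HPL.modelsSet_choiceH_standard PUnit n m)
      (HPL.models_WO1_standard PUnit)
  · exact HPL.independent_of_models HPL.isHenkin_fraenkel hall HPL.models_neg_WO1_fraenkel
      (HPL.isHenkin_standard PUnit)
      (HPL.modelsSet_choiceHAll (HPL.modelsSet_choiceH_standard PUnit))
      (HPL.models_WO1_standard PUnit)
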